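/- A subset $A$ of a group $G$ is called $k$-stable if there do not exist $a_1,\dots,a_k,b_1,\dots,b_k\in G$ such that, for all $1\le i,j\le k$, $a_ib_j\in A$ if and only if $i\le j$. **Theorem 1.6.** For every natural number $k$ there are constants $K_k\in\mathbb{R}$ and $N_k\in\mathbb{N}$, depending only on $k$, such that the following holds. Let $G$ be any group, let $A\subseteq G$ be a finite nonempty $k$-stable set, let $c$ be a real number with $|AA^{-1}A|\le c|A|$, and let $0<\epsilon\le\frac12$. Then there is a subgroup $H\le G$ with the following properties. (i) $H\subseteq A^{-1}A$, and $A\subseteq CH$ for some $C\subseteq A$ with $|C|\le K_k\,(c\,\epsilon^{-1})^{N_k}$. (ii) There is a set $D\subseteq C$, with $C$ as in (i), such that $|A\mathbin{\triangle} DH|<\epsilon|H|$. -/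

import Mathlib

open scoped Pointwise symmDiff

/-- A subset `A` of a group `G` is `k`-stable if there do not exist `a₁, …, a_k, b₁, …, b_k ∈ G`
such that `aᵢ bⱼ ∈ A` if and only if `i ≤ j`. -/
def IsKStable {G : Type*} [Group G] (k : ℕ) (A : Set G) : Prop :=
  ¬ ∃ a b : Fin k → G, ∀ i j : Fin k, a i * b j ∈ A ↔ i ≤ j

/-! Let `A` be stable and call `d g = #(A g ∆ A)` the distance by which `g` moves `A`.

By Hodges's argument, stability bounds the height of the binary trees for the relation `x * y ∈ A`.
This is used twice. First, a large family of `g ∈ A` whose mutual distances `d (g⁻¹ * h)` are all at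
least a fixed proportion of `#A` would yield a high tree, because some `x` splits any such family
into two parts of positive proportion. Hence a positive proportion of `A⁻¹ * A` moves `A` only
slightly. Second, if at each of many consecutive scales some `g` moved `A` by an amount between this
scale and the next one, then these elements would combine to a high tree. So some scale shows a gap,
and by the triangle inequality for `d` the elements moving `A` by less than this scale form a
subgroup `H`.

Finally `A` is close to the set of all `y` for which most of the coset `y * H` lies in `A`, which is
a union of cosets of `H`. -/

section Trees

variable {X Y : Type*} {R : X → Y → Prop}

/-- `HasTree R n U V` says that there is a complete binary tree of height `n` whose inner nodes are
labelled by elements of `U`, whose leaves are labelled by elements of `V`, and such that a leaf `y`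
below a node `x` satisfies `R x y` exactly if it lies to the left of `x`. The least `n` for which
there is no such tree measures the stability of `R` (Shelah's 2-rank, or Littlestone dimension). -/
def HasTree (R : X → Y → Prop) : ℕ → Set X → Set Y → Prop
  | 0, _, V => V.Nonempty
  | n + 1, U, V => ∃ x ∈ U, HasTree R n U {y ∈ V | R x y} ∧ HasTree R n U {y ∈ V | ¬ R x y}

/-- `HasLadder R n U V` says that there are `x₁, …, xₙ ∈ U` and `y₁, …, yₙ ∈ V` such that
`R xᵢ yⱼ` holds if and only if `j ≤ i`. It is defined by splitting off the first rung, so that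
ladders can be built inductively; see `HasLadder.exists_fin` for the indexed form. -/
def HasLadder (R : X → Y → Prop) : ℕ → Set X → Set Y → Prop
  | 0, _, _ => True
  | n + 1, U, V => ∃ x ∈ U, ∃ y ∈ V, R x y ∧ HasLadder R n {x' ∈ U | R x' y} {y' ∈ V | ¬ R x y'}

theorem HasTree.mono {n : ℕ} {U U' : Set X} {V V' : Set Y} (h : HasTree R n U V)
    (hU : U ⊆ U') (hV : V ⊆ V') : HasTree R n U' V' := by
  induction n generalizing V V' with
  | zero => exact Set.Nonempty.mono hV h
  | succ n ih =>
    obtain ⟨x, hx, hl, hr⟩ := h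
    exact ⟨x, hU hx, ih hl fun y hy ↦ ⟨hV hy.1, hy.2⟩, ih hr fun y hy ↦ ⟨hV hy.1, hy.2⟩⟩

theorem HasTree.nonempty {n : ℕ} {U : Set X} {V : Set Y} (h : HasTree R n U V) : V.Nonempty := by
  induction n generalizing V with
  | zero => exact h
  | succ n ih =>
    obtain ⟨x, _, hl, _⟩ := h
    exact (ih hl).mono (Set.sep_subset _ _)

theorem HasTree.of_union {n p q : ℕ} {U₁ U₂ : Set X} {V : Set Y}
    (h : HasTree R n (U₁ ∪ U₂) V) (hpq : p + q ≤ n) : HasTree R p U₁ V ∨ HasTree R q U₂ V := by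
  induction n generalizing p q V with
  | zero =>
    obtain rfl : p = 0 := by omega
    exact .inl h.nonempty
  | succ n ih =>
    have ⟨x, hx, hl, hr⟩ := h
    rcases hx with hx | hx
    · rcases p with _ | p
      · exact .inl h.nonempty
      rcases ih (p := p) (q := q) hl (by omega), ih (p := p) (q := q) hr (by omega) with
        ⟨hl | hl, hr | hr⟩
      · exact .inl ⟨x, hx, hl, hr⟩
      · exact .inr (hr.mono subset_rfl (Set.sep_subset _ _))
      all_goals exact .inr (hl.mono subset_rfl (Set.sep_subset _ _))
    · rcases q with _ | q
      · exact .inr h.nonempty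
      rcases ih (p := p) (q := q) hl (by omega), ih (p := p) (q := q) hr (by omega) with
        ⟨hl | hl, hr | hr⟩
      · exact .inl (hl.mono subset_rfl (Set.sep_subset _ _))
      · exact .inl (hl.mono subset_rfl (Set.sep_subset _ _))
      · exact .inl (hr.mono subset_rfl (Set.sep_subset _ _))
      · exact .inr ⟨x, hx, hl, hr⟩

theorem HasLadder.mono {n : ℕ} {U U' : Set X} {V V' : Set Y} (h : HasLadder R n U V)
    (hU : U ⊆ U') (hV : V ⊆ V') : HasLadder R n U' V' := by
  induction n generalizing U U' V V' with
  | zero => trivial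
  | succ n ih =>
    obtain ⟨x, hx, y, hy, hxy, h⟩ := h
    exact ⟨x, hU hx, y, hV hy, hxy,
      ih h (fun z hz ↦ ⟨hU hz.1, hz.2⟩) fun z hz ↦ ⟨hV hz.1, hz.2⟩⟩

theorem HasLadder.exists_fin {n : ℕ} {U : Set X} {V : Set Y} (h : HasLadder R n U V) :
    ∃ (x : Fin n → X) (y : Fin n → Y), (∀ i, x i ∈ U) ∧ (∀ j, y j ∈ V) ∧
      ∀ i j, R (x i) (y j) ↔ j ≤ i := by
  induction n generalizing U V with
  | zero => exact ⟨Fin.elim0, Fin.elim0, (·.elim0), (·.elim0), (·.elim0)⟩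
  | succ n ih =>
    obtain ⟨x₀, hx₀, y₀, hy₀, hxy, h⟩ := h
    obtain ⟨x, y, hx, hy, h⟩ := ih h
    refine ⟨Fin.cons x₀ x, Fin.cons y₀ y, Fin.cases hx₀ fun i ↦ (hx i).1,
      Fin.cases hy₀ fun j ↦ (hy j).1, Fin.cases (Fin.cases ?_ fun j ↦ ?_) fun i ↦
      Fin.cases ?_ fun j ↦ ?_⟩
    · simpa using hxy
    · simpa using (hy j).2
    · simpa using (hx i).2
    · simpa using h i j

theorem HasTree.hasLadder_or_hasLadder_not {a b n : ℕ} {U : Set X} {V : Set Y}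
    (h : HasTree R n U V) (hn : 2 * (a + b).choose a ≤ n + 2) :
    HasLadder R a U V ∨ HasLadder (fun x y ↦ ¬ R x y) b U V := by
  induction a generalizing b n U V with
  | zero => exact .inl trivial
  | succ a iha =>
  induction b generalizing n U V with
  | zero => exact .inr trivial
  | succ b ihb =>
    obtain ⟨y, hy⟩ := h.nonempty
    set p := (a + (b + 1)).choose a with hp
    set q := (a + 1 + b).choose (a + 1) with hq
    have hpq : (a + 1 + (b + 1)).choose (a + 1) = p + q := by
      rw [hp, hq, show a + (b + 1) = a + 1 + b by omega]
      exact Nat.choose_succ_succ' (a + 1 + b) a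
    have hp0 : 0 < p := Nat.choose_pos (by omega)
    have hq0 : 0 < q := Nat.choose_pos (by omega)
    replace h : HasTree R n ({x ∈ U | R x y} ∪ {x ∈ U | ¬ R x y}) V :=
      h.mono (fun x hx ↦ (em (R x y)).imp (⟨hx, ·⟩) (⟨hx, ·⟩)) subset_rfl
    rcases h.of_union (p := 2 * p - 2 + 1) (q := 2 * q - 2 + 1) (by omega) with
      ⟨x, hx, -, h⟩ | ⟨x, hx, h, -⟩
    · rcases iha h (b := b + 1) (by omega) with h | h
      · exact .inl ⟨x, hx.1, y, hy, hx.2, h⟩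
      · exact .inr (h.mono (Set.sep_subset _ _) (Set.sep_subset _ _))
    · rcases ihb h (by omega) with h | h
      · exact .inl (h.mono (Set.sep_subset _ _) (Set.sep_subset _ _))
      · exact .inr ⟨x, hx.1, y, hy, hx.2, h.mono subset_rfl fun z hz ↦ ⟨hz.1, not_not.2 hz.2⟩⟩

end Trees

section Packing

open Finset

variable {X Y : Type*} {R : X → Y → Prop} [∀ x, DecidablePred (R x)]

/-- Double counting of the triples `(x, y, y')` with `y ≠ y'` such that `x` separates them. -/
theorem exists_mul_card_offDiag_le {S : Finset X} {Q : Finset Y} {s : ℝ} (hS : S.Nonempty)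
    (hsep : (Q : Set Y).Pairwise fun y y' ↦ s ≤ #{x ∈ S | ¬ (R x y ↔ R x y')}) :
    ∃ x ∈ S, s * (#Q * (#Q - 1)) ≤ 2 * #S * (#{y ∈ Q | R x y} * #{y ∈ Q | ¬ R x y} : ℝ) := by
  classical
  have hcount : (∑ x ∈ S, #{p ∈ Q.offDiag | ¬ (R x p.1 ↔ R x p.2)} : ℝ) =
      ∑ p ∈ Q.offDiag, (#{x ∈ S | ¬ (R x p.1 ↔ R x p.2)} : ℝ) := by
    exact_mod_cast sum_card_bipartiteAbove_eq_sum_card_bipartiteBelow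
      fun x (p : Y × Y) ↦ ¬ (R x p.1 ↔ R x p.2)
  have hpairs : (#Q.offDiag : ℝ) = #Q * (#Q - 1) := by
    rw [offDiag_card, Nat.cast_sub (Nat.le_mul_self _)]; push_cast; ring
  obtain ⟨x, hx, hxs⟩ : ∃ x ∈ S, s * (#Q * (#Q - 1)) / #S ≤
      (#{p ∈ Q.offDiag | ¬ (R x p.1 ↔ R x p.2)} : ℝ) := by
    refine exists_le_of_sum_le hS ?_
    rw [sum_const, nsmul_eq_mul, mul_div_cancel₀ _ (by simpa using hS.ne_empty), hcount, ← hpairs,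
      mul_comm, ← nsmul_eq_mul]
    refine card_nsmul_le_sum _ _ _ fun p hp ↦ ?_
    obtain ⟨h₁, h₂, hne⟩ := mem_offDiag.1 hp
    exact hsep h₁ h₂ hne
  refine ⟨x, hx, ?_⟩
  set a := #{y ∈ Q | R x y}
  set b := #{y ∈ Q | ¬ R x y}
  have hsplit : #{p ∈ Q.offDiag | ¬ (R x p.1 ↔ R x p.2)} ≤ a * b + b * a := by
    simp only [a, b, ← card_product]
    refine (card_le_card fun p hp ↦ ?_).trans (card_union_le _ _)
    simp only [mem_filter, mem_offDiag, mem_union, mem_product] at hp ⊢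
    tauto
  have hsplit' : (#{p ∈ Q.offDiag | ¬ (R x p.1 ↔ R x p.2)} : ℝ) ≤ a * b + b * a := mod_cast hsplit
  rw [div_le_iff₀ (by exact_mod_cast hS.card_pos)] at hxs
  nlinarith

theorem exists_balanced_split {S : Finset X} {Q : Finset Y} {s : ℝ} (hS : S.Nonempty)
    (hQ : 1 < #Q) (hs : 0 < s)
    (hsep : (Q : Set Y).Pairwise fun y y' ↦ s ≤ #{x ∈ S | ¬ (R x y ↔ R x y')}) :
    ∃ x ∈ S, s * #Q ≤ 2 * #S * #{y ∈ Q | R x y} ∧ s * #Q ≤ 2 * #S * #{y ∈ Q | ¬ R x y} := by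
  obtain ⟨x, hx, hprod⟩ := exists_mul_card_offDiag_le hS hsep
  set a := #{y ∈ Q | R x y}
  set b := #{y ∈ Q | ¬ R x y}
  have hab : (a + b : ℝ) = #Q := mod_cast card_filter_add_card_filter_not _
  have hQ' : (0 : ℝ) < #Q - 1 := by simpa using hQ
  have hpos : (0 : ℝ) < a * b := by
    have : 0 < s * (#Q * (#Q - 1)) := by positivity
    exact pos_of_mul_pos_right (this.trans_le hprod) (by positivity)
  have ha : (1 : ℝ) ≤ a := mod_cast Nat.pos_of_ne_zero fun h ↦ by simp [h] at hpos
  have hb : (1 : ℝ) ≤ b := mod_cast Nat.pos_of_ne_zero fun h ↦ by simp [h] at hpos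
  have ha' : (a : ℝ) ≤ #Q - 1 := by linarith
  have hb' : (b : ℝ) ≤ #Q - 1 := by linarith
  refine ⟨x, hx, le_of_mul_le_mul_right ?_ hQ', le_of_mul_le_mul_right ?_ hQ'⟩
  · calc s * #Q * (#Q - 1) ≤ 2 * #S * (a * b) := by linarith
      _ ≤ 2 * #S * (a * (#Q - 1)) := by gcongr
      _ = 2 * #S * a * (#Q - 1) := by ring
  · calc s * #Q * (#Q - 1) ≤ 2 * #S * (a * b) := by linarith
      _ ≤ 2 * #S * ((#Q - 1) * b) := by gcongr
      _ = 2 * #S * b * (#Q - 1) := by ring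

theorem hasTree_of_separated {S : Finset X} {Q : Finset Y} {s : ℝ} {n : ℕ} (hs : 0 < s)
    (hsS : s ≤ #S)
    (hsep : (Q : Set Y).Pairwise fun y y' ↦ s ≤ #{x ∈ S | ¬ (R x y ↔ R x y')})
    (hQ : (2 * #S / s) ^ n ≤ #Q) : HasTree R n S Q := by
  induction n generalizing Q with
  | zero => exact card_pos.1 (by simpa [Nat.one_le_iff_ne_zero, pos_iff_ne_zero] using hQ)
  | succ n ih =>
    have hratio : 2 ≤ 2 * #S / s := by rw [le_div_iff₀ hs]; linarith
    have hQ1 : 1 < #Q := by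
      have : (1 : ℝ) < #Q := (one_lt_pow₀ (by linarith) n.succ_ne_zero).trans_le hQ
      exact_mod_cast this
    have hS : S.Nonempty := card_pos.1 (by exact_mod_cast hs.trans_le hsS)
    have hbig {t : ℝ} (ht : s * #Q ≤ 2 * #S * t) : (2 * #S / s) ^ n ≤ t := by
      refine le_of_mul_le_mul_right ?_ (show 0 < 2 * #S / s by linarith)
      rw [← pow_succ]
      refine hQ.trans ?_
      rwa [mul_div_assoc', le_div_iff₀ hs, mul_comm, mul_comm t]
    obtain ⟨x, hx, hl, hr⟩ := exists_balanced_split hS hQ1 hs hsep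
    refine ⟨x, hx, ?_, ?_⟩
    · simpa only [coe_filter] using! ih (hsep.mono (coe_subset.2 (filter_subset _ _))) (hbig hl)
    · simpa only [coe_filter] using! ih (hsep.mono (coe_subset.2 (filter_subset _ _))) (hbig hr)

end Packing

section Shift

open Finset
open scoped RightActions

variable {G : Type*} [Group G]

/-- A subset `A` of a group is tree-bounded with parameter `n` if the relation `x * y ∈ A` admits no
tree of height `n`. This is the form in which stability is used: it is what remains of
`k`-stability after passing from ladders to trees. -/
def IsTreeBounded (n : ℕ) (A : Set G) : Prop :=
  ¬ HasTree (fun x y : G ↦ x * y ∈ A) n Set.univ Set.univ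

theorem IsKStable.isTreeBounded {k : ℕ} {A : Set G} (hA : IsKStable k A) :
    IsTreeBounded (2 * (2 * k + 1).choose k) A := by
  intro h
  have hn : 2 * (k + (k + 1)).choose k ≤ 2 * (2 * k + 1).choose k + 2 := by
    rw [← add_assoc, ← two_mul]; omega
  rcases h.hasLadder_or_hasLadder_not hn with h | h <;>
    obtain ⟨x, y, -, -, hxy⟩ := h.exists_fin
  · exact hA ⟨fun i ↦ x i.rev, fun j ↦ y j.rev, fun i j ↦ by rw [hxy, Fin.rev_le_rev]⟩
  · refine hA ⟨fun i ↦ x i.castSucc, fun j ↦ y j.succ, fun i j ↦ ?_⟩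
    rw [← not_iff_not, hxy, not_le, Fin.succ_le_castSucc_iff]

theorem IsTreeBounded.ne_zero {n : ℕ} {A : Set G} (hA : IsTreeBounded n A) : n ≠ 0 := by
  rintro rfl
  exact hA Set.univ_nonempty

variable [DecidableEq G]

/-- The number of points at which `A` and its right translate by `g` differ. As a function of `g` it
is the length function of a left-invariant pseudometric on the group. -/
def shiftDist (A : Finset G) (g : G) : ℕ := #((A <• g) ∆ A)

theorem mem_smul_op_inv {A : Finset G} {g x : G} : x ∈ A <• g⁻¹ ↔ x * g ∈ A := by
  rw [MulOpposite.op_inv, mem_inv_smul_finset_iff, op_smul_eq_mul]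

theorem card_smul_symmDiff_smul (A : Finset G) (g h : G) :
    #((A <• g) ∆ (A <• h)) = shiftDist A (g * h⁻¹) := by
  rw [shiftDist, ← card_smul_finset (MulOpposite.op h) (_ ∆ A), smul_finset_symmDiff,
    op_smul_op_smul, inv_mul_cancel_right]

@[simp]
theorem shiftDist_one (A : Finset G) : shiftDist A 1 = 0 := by simp [shiftDist]

@[simp]
theorem shiftDist_inv (A : Finset G) (g : G) : shiftDist A g⁻¹ = shiftDist A g := by
  have h := card_smul_symmDiff_smul A 1 g
  rwa [MulOpposite.op_one, one_smul, symmDiff_comm, one_mul, ← shiftDist, eq_comm] at h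

theorem shiftDist_mul_le (A : Finset G) (g h : G) :
    shiftDist A (g * h) ≤ shiftDist A g + shiftDist A h := by
  have hg : #((A <• (g * h)) ∆ (A <• h)) = shiftDist A g := by
    rw [card_smul_symmDiff_smul, mul_inv_cancel_right]
  rw [← hg]
  exact (card_le_card (symmDiff_triangle _ (A <• h) _)).trans (card_union_le _ _)

theorem two_mul_card_smul_sdiff (A : Finset G) (g : G) :
    2 * #((A <• g) \ A) = shiftDist A g := by
  have h : #((A <• g) \ A) = #(A \ (A <• g)) := card_sdiff_comm (card_smul_finset _ _)
  have : shiftDist A g = #((A <• g) \ A) + #(A \ (A <• g)) :=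
    card_union_of_disjoint disjoint_sdiff_sdiff
  omega

theorem mem_inv_mul_of_shiftDist_lt {A : Finset G} {g : G} (hg : shiftDist A g < 2 * #A) :
    g ∈ A⁻¹ * A := by
  have hlt : #((A <• g) \ A) < #(A <• g) := by
    have := two_mul_card_smul_sdiff A g
    rw [card_smul_finset]
    omega
  obtain ⟨x, hxg, hx⟩ : ∃ x ∈ A <• g, x ∈ A := by
    by_contra! h
    rw [sdiff_eq_self_of_disjoint (disjoint_left.2 h)] at hlt
    exact hlt.false
  obtain ⟨a, ha, rfl⟩ := mem_smul_finset.1 hxg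
  exact mem_mul.2 ⟨a⁻¹, inv_mem_inv ha, a * g, hx, inv_mul_cancel_left a g⟩

/-- The subgroup of all elements that move `A` by at most `r`, provided that none of them moves `A`
by an amount in `(r, 2r]`. -/
def shiftStabilizer (A : Finset G) (r : ℝ) (hr : 0 ≤ r)
    (hgap : ∀ g, (shiftDist A g : ℝ) ≤ 2 * r → (shiftDist A g : ℝ) ≤ r) : Subgroup G where
  carrier := {g | (shiftDist A g : ℝ) ≤ r}
  one_mem' := by simpa using hr
  inv_mem' := by simp
  mul_mem' {g h} hg hh := by
    refine hgap _ ?_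
    have : (shiftDist A (g * h) : ℝ) ≤ shiftDist A g + shiftDist A h :=
      mod_cast shiftDist_mul_le A g h
    simp only [Set.mem_ofPred_eq] at hg hh
    linarith

end Shift

section Gap

open Finset
open scoped RightActions

variable {G : Type*} [Group G] [DecidableEq G]

/-- The set of all `x` for which `x * y ∈ A` fails to be equivalent to `x ∈ A` for some `y ∈ P`. -/
def movedPoints (A P : Finset G) : Finset G := P.biUnion fun y ↦ (A <• y⁻¹) ∆ A

theorem mem_movedPoints {A P : Finset G} {x : G} :
    x ∈ movedPoints A P ↔ ∃ y ∈ P, ¬ (x * y ∈ A ↔ x ∈ A) := by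
  simp only [movedPoints, mem_biUnion, mem_symmDiff, mem_smul_op_inv]
  grind

theorem card_movedPoints_union_smul_le (A P : Finset G) (g : G) :
    #(movedPoints A (P ∪ g • P)) ≤ 2 * #(movedPoints A P) + shiftDist A g := by
  have hsub : movedPoints A (P ∪ g • P) ⊆
      movedPoints A P ∪ (movedPoints A P <• g⁻¹) ∪ (A <• g⁻¹) ∆ A := by
    intro x hx
    simp only [mem_union, mem_smul_op_inv, mem_symmDiff, mem_movedPoints] at hx ⊢
    simp only [mem_smul_finset, smul_eq_mul] at hx
    obtain ⟨_, hy | ⟨y, hy, rfl⟩, hxy⟩ := hx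
    · exact .inl (.inl ⟨_, hy, hxy⟩)
    · by_cases hxg : x * g ∈ A ↔ x ∈ A
      · exact .inl (.inr ⟨y, hy, by rwa [hxg, mul_assoc]⟩)
      · exact .inr (by tauto)
  calc #(movedPoints A (P ∪ g • P))
      ≤ #(movedPoints A P) + #(movedPoints A P <• g⁻¹) + #((A <• g⁻¹) ∆ A) :=
        (card_le_card hsub).trans <|
          (card_union_le _ _).trans <| Nat.add_le_add_right (card_union_le _ _) _
    _ = 2 * #(movedPoints A P) + shiftDist A g := by
        rw [card_smul_finset, ← shiftDist, shiftDist_inv, two_mul]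

/-- Since `g` moves more points into `A` than `P` can disturb, some `x` has `x * g * P ⊆ A` and
`x * P` disjoint from `A`. The root of the new tree is `x * z⁻¹`. -/
theorem hasTree_succ_smul_union {A P : Finset G} {g : G} {n : ℕ}
    (hP : ∀ z : G, HasTree (fun x y : G ↦ x * y ∈ A) n Set.univ (z • (P : Set G)))
    (hg : 4 * #(movedPoints A P) < shiftDist A g) (z : G) :
    HasTree (fun x y : G ↦ x * y ∈ A) (n + 1) Set.univ (z • (↑(P ∪ g • P) : Set G)) := by
  obtain ⟨x, hx, hxP⟩ :
      ∃ x ∈ (A <• g⁻¹) \ A, x ∉ movedPoints A P ∪ (movedPoints A P <• g⁻¹) := by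
    refine exists_mem_notMem_of_card_lt_card ?_
    have h₁ := two_mul_card_smul_sdiff A g⁻¹
    have h₂ := card_union_le (movedPoints A P) (movedPoints A P <• g⁻¹)
    rw [card_smul_finset] at h₂
    rw [shiftDist_inv] at h₁
    omega
  simp only [mem_sdiff, mem_union, mem_smul_op_inv, mem_movedPoints, not_or, not_exists, not_and,
    not_not] at hx hxP
  refine ⟨x * z⁻¹, trivial, (hP (z * g)).mono subset_rfl ?_, (hP z).mono subset_rfl ?_⟩
  · rintro _ ⟨y, hy, rfl⟩
    have hxy : x * g * y ∈ A := (hxP.2 y hy).2 hx.1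
    refine ⟨⟨g * y, by simpa using .inr (Set.smul_mem_smul_set hy), by simp [mul_assoc]⟩, ?_⟩
    simpa [mul_assoc] using hxy
  · rintro _ ⟨y, hy, rfl⟩
    have hxy : x * y ∉ A := mt (hxP.1 y hy).1 hx.2
    exact ⟨⟨y, by simpa using .inl hy, rfl⟩, by simpa [mul_assoc] using hxy⟩

theorem exists_hasTree_of_scales (A : Finset G) {s : ℕ → ℝ} {N : ℕ} (hs : ∀ m, 0 ≤ s m)
    (hmove : ∀ m < N, ∃ g, (shiftDist A g : ℝ) ≤ s m ∧ 8 * s (m + 1) < shiftDist A g) (n m : ℕ)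
    (hmn : m + n ≤ N) :
    ∃ P : Finset G, (#(movedPoints A P) : ℝ) ≤ 2 * s m ∧
      ∀ z : G, HasTree (fun x y : G ↦ x * y ∈ A) n Set.univ (z • (P : Set G)) := by
  induction n generalizing m with
  | zero =>
    refine ⟨{1}, by simpa [movedPoints] using hs m, fun z ↦ ?_⟩
    exact (Set.singleton_nonempty z).mono (by simp)
  | succ n ih =>
    obtain ⟨P, hPm, hP⟩ := ih (m + 1) (by omega)
    obtain ⟨g, hgs, hgr⟩ := hmove m (by omega)
    have hcard : (#(movedPoints A (P ∪ g • P)) : ℝ) ≤ 2 * #(movedPoints A P) + shiftDist A g :=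
      mod_cast card_movedPoints_union_smul_le A P g
    refine ⟨P ∪ g • P, by linarith, hasTree_succ_smul_union hP ?_⟩
    have : (4 * #(movedPoints A P) : ℝ) < shiftDist A g := by linarith
    exact_mod_cast this

theorem IsTreeBounded.exists_gap {n : ℕ} {A : Finset G} (hA : IsTreeBounded n (A : Set G))
    {s : ℕ → ℝ} (hs : ∀ m, 0 ≤ s m) :
    ∃ m < n, ∀ g, (shiftDist A g : ℝ) ≤ s m → (shiftDist A g : ℝ) ≤ 8 * s (m + 1) := by
  by_contra! h
  obtain ⟨P, -, hP⟩ := exists_hasTree_of_scales A hs h n 0 (by omega)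
  exact hA ((hP 1).mono subset_rfl (Set.subset_univ _))

end Gap

section Structure

open Finset
open scoped RightActions

variable {G : Type*} [Group G] [DecidableEq G]

/-- Among the elements of `A`, take a maximal family that is `s`-separated for the pseudometric
`(g, h) ↦ shiftDist A (g⁻¹ * h)`. By `hasTree_of_separated` it is small, and by maximality each
element of `A` lies within distance `s` of a member of the family. -/
theorem IsTreeBounded.card_le_mul_card_almost_invariant {n : ℕ} {A : Finset G}
    (hA : IsTreeBounded n (A : Set G)) {s : ℝ} (hs : 0 < s) (hsA : s ≤ #(A * A⁻¹)) :
    (#A : ℝ) ≤ (2 * #(A * A⁻¹) / s) ^ n * #{g ∈ A⁻¹ * A | (shiftDist A g : ℝ) ≤ s} := by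
  let close : SetRel G G := {p | (shiftDist A (p.1⁻¹ * p.2) : ℝ) ≤ s}
  have : close.IsRefl := ⟨fun g ↦ by simpa [close] using hs.le⟩
  have : close.IsSymm := ⟨fun g h hgh ↦ by
    simpa only [close, Set.mem_ofPred_eq, ← shiftDist_inv A (h⁻¹ * g), mul_inv_rev, inv_inv]
      using hgh⟩
  obtain ⟨Q, hQ⟩ : ∃ Q : Set G, Maximal (fun Q ↦ Q ⊆ (A : Set G) ∧ close.IsSeparated Q) Q :=
    (A.finite_toSet.finite_subsets.subset fun Q hQ ↦ hQ.1).exists_maximal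
      ⟨∅, Set.empty_subset _, .empty⟩
  have hcover := SetRel.IsCover.of_maximal_isSeparated hQ
  lift Q to Finset G using A.finite_toSet.subset hQ.prop.1
  obtain ⟨hQA, hQsep⟩ : Q ⊆ A ∧ close.IsSeparated (Q : Set G) := by exact_mod_cast hQ.prop
  have hQcard : (#Q : ℝ) ≤ (2 * #(A * A⁻¹) / s) ^ n := by
    by_contra! hlt
    refine hA ((hasTree_of_separated hs hsA (fun g hg h hh hne ↦ ?_) hlt.le).mono
      (Set.subset_univ _) (Set.subset_univ _))
    have hgh : s < shiftDist A (g⁻¹ * h) := not_le.1 (hQsep hg hh hne)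
    have hsub : (A <• g⁻¹) ∆ (A <• h⁻¹) ⊆ {x ∈ A * A⁻¹ | ¬ (x * g ∈ A ↔ x * h ∈ A)} := by
      intro x hx
      simp only [mem_symmDiff, mem_smul_op_inv, mem_filter] at hx ⊢
      refine ⟨?_, by tauto⟩
      rcases hx with ⟨hx, -⟩ | ⟨hx, -⟩
      · simpa using mul_mem_mul hx (inv_mem_inv (hQA hg))
      · simpa using mul_mem_mul hx (inv_mem_inv (hQA hh))
    have hle := card_le_card hsub
    rw [card_smul_symmDiff_smul, inv_inv] at hle
    exact hgh.le.trans (by exact_mod_cast hle)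
  set T := {g ∈ A⁻¹ * A | (shiftDist A g : ℝ) ≤ s}
  have hAQ : A ⊆ Q * T := by
    intro a ha
    obtain ⟨q, hq, haq⟩ := hcover ha
    refine mem_mul.2 ⟨q, hq, q⁻¹ * a, mem_filter.2 ⟨?_, close.symm haq⟩, mul_inv_cancel_left q a⟩
    exact mul_mem_mul (inv_mem_inv (hQA hq)) ha
  calc (#A : ℝ) ≤ #Q * #T := mod_cast (card_le_card hAQ).trans card_mul_le
    _ ≤ _ := by gcongr

/-- The set of all `y` such that `y * h ∈ A` for more than half of the elements `h` of `S`. Such a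
`y` lies in `A * S⁻¹` automatically; the restriction only makes this a finset. -/
def rightMajority (A S : Finset G) : Finset G :=
  {y ∈ A * S⁻¹ | #S < 2 * #{h ∈ S | y * h ∈ A}}

theorem mem_rightMajority {A S : Finset G} {y : G} :
    y ∈ rightMajority A S ↔ #S < 2 * #{h ∈ S | y * h ∈ A} := by
  refine mem_filter.trans (and_iff_right_of_imp fun hy ↦ ?_)
  obtain ⟨h, hh⟩ : {h ∈ S | y * h ∈ A}.Nonempty := card_pos.1 (by omega)
  obtain ⟨hhS, hyh⟩ := mem_filter.1 hh
  simpa using mul_mem_mul hyh (inv_mem_inv hhS)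

theorem card_symmDiff_rightMajority_mul_le (A S : Finset G) :
    #(A ∆ rightMajority A S) * #S ≤ 2 * ∑ h ∈ S, shiftDist A h := by
  set D := A ∆ rightMajority A S with hD
  have hhalf : ∀ y ∈ D, #S ≤ 2 * #{h ∈ S | ¬ (y * h ∈ A ↔ y ∈ A)} := by
    intro y hy
    have hadd := card_filter_add_card_filter_not (s := S) (fun h ↦ y * h ∈ A)
    rw [hD, mem_symmDiff, mem_rightMajority] at hy
    rcases hy with ⟨hyA, hy⟩ | ⟨hy, hyA⟩ <;> simp only [hyA, iff_true, iff_false, not_not] <;> omega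
  have hmoved : ∀ h ∈ S, #{y ∈ D | ¬ (y * h ∈ A ↔ y ∈ A)} ≤ shiftDist A h := by
    intro h _
    rw [← shiftDist_inv, shiftDist]
    refine card_le_card fun y hy ↦ ?_
    simp only [mem_filter, mem_symmDiff, mem_smul_op_inv] at hy ⊢
    tauto
  calc #D * #S = ∑ _y ∈ D, #S := by rw [sum_const, smul_eq_mul]
    _ ≤ ∑ y ∈ D, 2 * #{h ∈ S | ¬ (y * h ∈ A ↔ y ∈ A)} := sum_le_sum hhalf
    _ = 2 * ∑ h ∈ S, #{y ∈ D | ¬ (y * h ∈ A ↔ y ∈ A)} := by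
        rw [← mul_sum]
        congr 1
        exact sum_card_bipartiteAbove_eq_sum_card_bipartiteBelow fun y h ↦ ¬ (y * h ∈ A ↔ y ∈ A)
    _ ≤ 2 * ∑ h ∈ S, shiftDist A h := Nat.mul_le_mul_left 2 (sum_le_sum hmoved)

section Subgroup

variable {A C S : Finset G} {H : Subgroup G}

theorem mul_mem_rightMajority_iff (hS : (S : Set G) = H) {y h : G} (hh : h ∈ S) :
    y * h ∈ rightMajority A S ↔ y ∈ rightMajority A S := by
  have hmem : ∀ x, x ∈ S ↔ x ∈ H := Set.ext_iff.1 hS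
  have hfilter : {g ∈ S | y * h * g ∈ A} = h⁻¹ • {g ∈ S | y * g ∈ A} := by
    ext g
    simp only [mem_inv_smul_finset_iff, mem_filter, smul_eq_mul, hmem, mul_assoc,
      H.mul_mem_cancel_left ((hmem h).1 hh)]
  rw [mem_rightMajority, mem_rightMajority, hfilter, card_smul_finset]

theorem exists_mul_eq_rightMajority (hS : (S : Set G) = H) (hAC : A ⊆ C * S) :
    ∃ D ⊆ C, D * S = rightMajority A S := by
  have hmem : ∀ x, x ∈ S ↔ x ∈ H := Set.ext_iff.1 hS
  refine ⟨{d ∈ C | d ∈ rightMajority A S}, filter_subset _ _, ?_⟩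
  ext y
  constructor
  · intro hy
    obtain ⟨d, hd, h, hh, rfl⟩ := mem_mul.1 hy
    exact (mul_mem_rightMajority_iff hS hh).2 (mem_filter.1 hd).2
  · intro hy
    obtain ⟨a, ha, g, hg, rfl⟩ := mem_mul.1 (mem_filter.1 hy).1
    obtain ⟨d, hd, h, hh, rfl⟩ := mem_mul.1 (hAC ha)
    have hhg : h * g ∈ S :=
      (hmem _).2 (H.mul_mem ((hmem _).1 hh) (inv_mem_iff.1 ((hmem _).1 (mem_inv'.1 hg))))
    rw [mul_assoc] at hy ⊢
    exact mul_mem_mul (mem_filter.2 ⟨hd, (mul_mem_rightMajority_iff hS hhg).1 hy⟩) hhg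

theorem exists_coset_approximation (hS : (S : Set G) = H) {r : ℝ}
    (hr : ∀ h ∈ S, (shiftDist A h : ℝ) ≤ r) :
    ∃ C ⊆ A, #C * #S ≤ #(A * S) ∧ A ⊆ C * S ∧ ∃ D ⊆ C, (#(A ∆ (D * S)) : ℝ) ≤ 2 * r := by
  have hSne : S.Nonempty := by rw [← coe_nonempty, hS]; exact OneMemClass.coe_nonempty H
  have hSpos : (0 : ℝ) < #S := mod_cast hSne.card_pos
  have hdiv : S / S = S := by rw [← coe_inj, coe_div, hS, coe_div_coe]
  obtain ⟨C, hCA, hC, hAC⟩ :=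
    ruzsa_covering_mul (A := A) (K := #(A * S) / #S) hSne (div_mul_cancel₀ _ hSpos.ne').ge
  rw [hdiv] at hAC
  obtain ⟨D, hDC, hD⟩ := exists_mul_eq_rightMajority hS hAC
  refine ⟨C, hCA, ?_, hAC, D, hDC, ?_⟩
  · rw [le_div_iff₀ hSpos] at hC
    exact_mod_cast hC
  · have hsum : (∑ h ∈ S, (shiftDist A h : ℝ)) ≤ #S * r := by
      simpa only [nsmul_eq_mul] using sum_le_card_nsmul S _ r hr
    have hmaj : (#(A ∆ rightMajority A S) * #S : ℝ) ≤ 2 * ∑ h ∈ S, (shiftDist A h : ℝ) :=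
      mod_cast card_symmDiff_rightMajority_mul_le A S
    rw [hD]
    refine le_of_mul_le_mul_right (hmaj.trans ?_) hSpos
    linarith

end Subgroup

theorem IsTreeBounded.exists_subgroup_of_gap {n : ℕ} {A : Finset G}
    (hA : IsTreeBounded n (A : Set G)) {r s : ℝ} (hs : 0 < s) (hrs : 2 * r ≤ s) (hsA : s ≤ #A)
    (hgap : ∀ g, (shiftDist A g : ℝ) ≤ s → (shiftDist A g : ℝ) ≤ r) :
    ∃ (H : Subgroup G) (S : Finset G), (S : Set G) = H ∧ S ⊆ A⁻¹ * A ∧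
      (#A : ℝ) ≤ (2 * #(A * A⁻¹) / s) ^ n * #S ∧
      ∃ C ⊆ A, #C * #S ≤ #(A * A⁻¹ * A) ∧ A ⊆ C * S ∧
        ∃ D ⊆ C, (#(A ∆ (D * S)) : ℝ) ≤ 2 * r := by
  have hApos : (0 : ℝ) < #A := hs.trans_le hsA
  have hAne : A.Nonempty := card_pos.1 (by exact_mod_cast hApos)
  have hr : 0 ≤ r := by simpa using hgap 1 (by simpa using hs.le)
  let H := shiftStabilizer A r hr fun g hg ↦ hgap g (hg.trans hrs)
  set S := {g ∈ A⁻¹ * A | (shiftDist A g : ℝ) ≤ s}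
  have hSA : S ⊆ A⁻¹ * A := filter_subset _ _
  have hS : (S : Set G) = H := by
    ext g
    refine ⟨fun hg ↦ hgap g (mem_filter.1 hg).2, fun hg : (shiftDist A g : ℝ) ≤ r ↦ ?_⟩
    refine mem_filter.2 ⟨mem_inv_mul_of_shiftDist_lt ?_, by linarith⟩
    have : (shiftDist A g : ℝ) < 2 * #A := by linarith
    exact_mod_cast this
  have hAA : #A ≤ #(A * A⁻¹) := card_le_card_mul_right hAne.inv
  have hcard := hA.card_le_mul_card_almost_invariant hs (hsA.trans (by exact_mod_cast hAA))
  obtain ⟨C, hCA, hC, hAC, D, hDC, hD⟩ :=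
    exists_coset_approximation (A := A) hS fun h hh ↦ hgap h (mem_filter.1 hh).2
  have hAS : #(A * S) ≤ #(A * A⁻¹ * A) := by
    rw [mul_assoc]; exact card_le_card (mul_subset_mul_left hSA)
  exact ⟨H, S, hS, hSA, hcard, C, hCA, hC.trans hAS, hAC, D, hDC, hD⟩

end Structure

section Scales

open Finset

/-- A scale of distances for the gap argument: in step `m`, the elements that move `A` by at most
`#A / scale n B m` are compared with those that move it by at most `8 * #A / scale n B (m + 1)`.
The exponents grow fast enough for `mul_mul_scale_pow_le`. -/
def scale (n : ℕ) (B : ℝ) (m : ℕ) : ℝ := B ^ (n + 1) ^ (m + 1)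

variable {n m : ℕ} {B : ℝ}

theorem scale_pos (hB : 1 ≤ B) : 0 < scale n B m := pow_pos (by linarith) _

theorem mul_mul_scale_pow_le (hB : 1 ≤ B) :
    B * (B * scale n B m) ^ n ≤ scale n B (m + 1) := by
  have hexp : 1 + (1 + (n + 1) ^ (m + 1)) * n ≤ (n + 1) ^ (m + 1 + 1) := by
    have : n + 1 ≤ (n + 1) ^ (m + 1) := Nat.le_self_pow (by omega) _
    rw [pow_succ (n + 1) (m + 1)]
    nlinarith
  calc B * (B * scale n B m) ^ n = B ^ (1 + (1 + (n + 1) ^ (m + 1)) * n) := by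
        rw [scale, ← pow_succ', ← pow_mul, ← pow_succ', add_comm 1 ((n + 1) ^ (m + 1)), add_comm 1]
    _ ≤ scale n B (m + 1) := pow_le_pow_right₀ hB hexp

theorem mul_scale_le (hB : 1 ≤ B) (hn : n ≠ 0) : B * scale n B m ≤ scale n B (m + 1) := by
  have hone : 1 ≤ B * scale n B m := one_le_mul_of_one_le_of_one_le hB (one_le_pow₀ hB)
  calc B * scale n B m ≤ (B * scale n B m) ^ n := le_self_pow₀ hone hn
    _ ≤ B * (B * scale n B m) ^ n := le_mul_of_one_le_left (by positivity) hB
    _ ≤ scale n B (m + 1) := mul_mul_scale_pow_le hB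

theorem scale_le_scale {m' : ℕ} (hB : 1 ≤ B) (hm : m ≤ m') : scale n B m ≤ scale n B m' :=
  pow_le_pow_right₀ hB (Nat.pow_le_pow_right n.succ_pos (by omega))

end Scales

section Approximation

open Finset

variable {G : Type*} [Group G] [DecidableEq G] {n : ℕ} {A : Finset G} {B c ε : ℝ}

theorem IsTreeBounded.exists_subgroup_of_scale (hA : IsTreeBounded n (A : Set G))
    (hne : A.Nonempty) (hAA : 2 * (#(A * A⁻¹) : ℝ) ≤ B * #A) (hB : 16 ≤ B) :
    ∃ (H : Subgroup G) (S : Finset G), (S : Set G) = H ∧ S ⊆ A⁻¹ * A ∧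
      ∃ t, 0 < t ∧ t ≤ B ^ (n + 1) ^ (n + 1) ∧ B * #A ≤ t * #S ∧
      ∃ C ⊆ A, #C * #S ≤ #(A * A⁻¹ * A) ∧ A ⊆ C * S ∧
        ∃ D ⊆ C, t * #(A ∆ (D * S)) ≤ 16 * #A := by
  have hB1 : 1 ≤ B := by linarith
  have hApos : (0 : ℝ) < #A := mod_cast hne.card_pos
  have hscale (m : ℕ) : 0 < scale n B m := scale_pos hB1
  obtain ⟨m, hmn, hgap⟩ := hA.exists_gap (s := fun m ↦ #A / scale n B m) fun m ↦
    (div_pos hApos (hscale m)).le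
  have hgap_width : 2 * (8 * (#A / scale n B (m + 1))) ≤ #A / scale n B m := by
    have : 16 * scale n B m ≤ scale n B (m + 1) :=
      (mul_le_mul_of_nonneg_right hB (hscale m).le).trans (mul_scale_le hB1 hA.ne_zero)
    rw [← mul_assoc, mul_div_assoc', div_le_div_iff₀ (hscale _) (hscale _)]
    nlinarith
  obtain ⟨H, S, hSH, hSA, hAS, C, hCA, hCS, hAC, D, hDC, hD⟩ :=
    hA.exists_subgroup_of_gap (div_pos hApos (hscale m)) hgap_width
      (div_le_self hApos.le (one_le_pow₀ hB1)) hgap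
  have hratio : 2 * #(A * A⁻¹) / (#A / scale n B m) ≤ B * scale n B m := by
    rw [div_div_eq_mul_div, div_le_iff₀ hApos, mul_right_comm B]
    exact mul_le_mul_of_nonneg_right hAA (hscale m).le
  have hindex : B * #A ≤ scale n B (m + 1) * #S :=
    calc B * #A ≤ B * ((B * scale n B m) ^ n * #S) := by
          gcongr
          refine hAS.trans (mul_le_mul_of_nonneg_right ?_ (Nat.cast_nonneg _))
          exact pow_le_pow_left₀ (div_nonneg (by positivity) (by have := hscale m; positivity))
            hratio n
      _ = B * (B * scale n B m) ^ n * #S := (mul_assoc _ _ _).symm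
      _ ≤ scale n B (m + 1) * #S := by gcongr; exact mul_mul_scale_pow_le hB1
  refine ⟨H, S, hSH, hSA, scale n B (m + 1), hscale _, scale_le_scale hB1 hmn, hindex,
    C, hCA, hCS, hAC, D, hDC, ?_⟩
  rw [← le_div_iff₀' (hscale _)]
  exact hD.trans_eq (by ring)

theorem IsTreeBounded.exists_subgroup_approximation (hA : IsTreeBounded n (A : Set G))
    (hne : A.Nonempty) (hc : (#(A * A⁻¹ * A) : ℝ) ≤ c * #A) (hε0 : 0 < ε) (hε1 : ε ≤ 1) :
    ∃ (H : Subgroup G) (S : Finset G), (S : Set G) = H ∧ S ⊆ A⁻¹ * A ∧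
      ∃ C ⊆ A, (#C : ℝ) ≤ (32 * (c * ε⁻¹)) ^ (n + 1) ^ (n + 1) ∧ A ⊆ C * S ∧
        ∃ D ⊆ C, (#(A ∆ (D * S)) : ℝ) < ε * #S := by
  have hApos : (0 : ℝ) < #A := mod_cast hne.card_pos
  have hAA : (#(A * A⁻¹) : ℝ) ≤ c * #A := le_trans (mod_cast card_le_card_mul_right hne) hc
  have hc1 : 1 ≤ c := by
    have : (#A : ℝ) ≤ #(A * A⁻¹) := mod_cast card_le_card_mul_right hne.inv
    exact le_of_mul_le_mul_right (by linarith) hApos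
  have hcε : c ≤ c * ε⁻¹ := le_mul_of_one_le_right (by linarith) ((one_le_inv₀ hε0).2 hε1)
  obtain ⟨H, S, hSH, hSA, t, ht, htB, hindex, C, hCA, hCS, hAC, D, hDC, hD⟩ :=
    hA.exists_subgroup_of_scale hne (B := 32 * (c * ε⁻¹)) (by nlinarith) (by linarith)
  have hSpos : (0 : ℝ) < #S := pos_of_mul_pos_right (lt_of_lt_of_le (by positivity) hindex) ht.le
  refine ⟨H, S, hSH, hSA, C, hCA, le_trans ?_ htB, hAC, D, hDC, ?_⟩
  · have hCS' : (#C * #S : ℝ) ≤ #(A * A⁻¹ * A) := mod_cast hCS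
    exact le_of_mul_le_mul_right (by nlinarith) hSpos
  · have hε : ε * (32 * (c * ε⁻¹)) = 32 * c := by field_simp
    have hAS : 32 * c * #A ≤ t * (ε * #S) := by
      rw [← hε, mul_assoc, mul_left_comm t]
      exact mul_le_mul_of_nonneg_left hindex hε0.le
    refine lt_of_mul_lt_mul_left ?_ ht.le
    nlinarith

end Approximation

theorem theorem1p6 (k : ℕ) :
    ∃ (K : ℝ) (N : ℕ), ∀ (G : Type*) [Group G] (A : Set G) (c ε : ℝ),
      A.Finite → A.Nonempty → IsKStable k A →
      ((A * A⁻¹ * A).ncard : ℝ) ≤ c * (A.ncard : ℝ) →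
      0 < ε → ε ≤ 1 / 2 →
      ∃ H : Subgroup G, (H : Set G) ⊆ A⁻¹ * A ∧
        ∃ C : Set G, C ⊆ A ∧ (C.ncard : ℝ) ≤ K * (c * ε⁻¹) ^ N ∧ A ⊆ C * (H : Set G) ∧
          ∃ D : Set G, D ⊆ C ∧
            ((A ∆ (D * (H : Set G))).ncard : ℝ) < ε * ((H : Set G).ncard : ℝ) := by
  set n := 2 * (2 * k + 1).choose k
  refine ⟨32 ^ (n + 1) ^ (n + 1), (n + 1) ^ (n + 1), fun G _ A c ε hfin hne hA hc hε0 hε1 ↦ ?_⟩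
  classical
  lift A to Finset G using hfin
  rw [← Finset.coe_inv, ← Finset.coe_mul, ← Finset.coe_mul, Set.ncard_coe_finset,
    Set.ncard_coe_finset] at hc
  obtain ⟨H, S, hSH, hSA, C, hCA, hC, hAC, D, hDC, hD⟩ :=
    hA.isTreeBounded.exists_subgroup_approximation (mod_cast hne) hc hε0 (by linarith)
  rw [mul_pow] at hC
  refine ⟨H, ?_, C, mod_cast hCA, by rwa [Set.ncard_coe_finset], ?_, D, mod_cast hDC, ?_⟩
  · rw [← hSH]; exact_mod_cast hSA
  · rw [← hSH]; exact_mod_cast hAC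
  · rw [← hSH, ← Finset.coe_mul, ← Finset.coe_symmDiff, Set.ncard_coe_finset,
      Set.ncard_coe_finset]
    exact hD
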